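/- Let $G$ be a finite connected simple directed graph (no loops, no parallel arcs) without antiparallel arcs, with vertex set $V(G)$ and arc set $A(G)$. Let $T\ge 1$ be an integer (the period), let $\ell,u\in\mathbb{Z}^{A(G)}$ be integral lower and upper bounds, and let $w\in\mathbb{R}^{A(G)}$ be arc weights, so that $(G,T,\ell,u,w)$ is an integral instance of the Periodic Event Scheduling Problem (PESP). A feasible periodic tension is a vector $x\in\mathbb{R}^{A(G)}$ with $\ell\le x\le u$ for which there is $\pi\in\mathbb{R}^{V(G)}$ with $x_{a}-(\pi_j-\pi_i)\in T\mathbb{Z}$ for every arc $a=(i,j)$. Let $B$ be the incidence matrix of $G$. An oriented cycle is a vector $\gamma\in\{-1,0,1\}^{A(G)}$ with $B\gamma=0$; the oriented cycles generate a subgroup of $\mathbb{Z}^{A(G)}$, the cycle space, whose rank is denoted by $\mu$. Let $\mathscr{B}=(\gamma_1,\dots,\gamma_\mu)$ be an integral cycle basis, i.e. a $\mu$-tuple of oriented cycles that generate the cycle space over $\mathbb{Z}$, let $\Gamma\in\mathbb{Z}^{\mathscr{B}\times A(G)}$ be the matrix with rows $\gamma_1,\dots,\gamma_\mu$, and let $$Z=\{z\in\mathbb{R}^{\mathscr{B}}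 \mid \exists\, x\in\mathbb{R}^{A(G)}:\ \Gamma x=Tz,\ \ell\le x\le u\}$$ be the cycle offset zonotope. A structure is a triple $(S,L,U)$ of subsets of $A(G)$ with $S=L\cup U$ and $L\cap U=\varnothing$. It is a spanning structure if $(V(G),S)$ is connected (as an undirected graph), and a spanning tree structure if $(V(G),S)$ is a tree. A feasible solution for $(S,L,U)$ is a feasible periodic tension $x$ with $x_a=\ell_a$ for all $a\in L$ and $x_a=u_a$ for all $a\in U$. Suppose that every arc is free, i.e. $u_a-\ell_a=T-1$ for all $a\in A(G)$, and that there is no degeneracy, i.e. every spanning structure for which a feasible solution exists is a spanning tree structure. Then the number of integer points of $Z$, i.e. $|Z\cap\mathbb{Z}^{\mathscr{B}}|$, equals the number of spanning trees of $G$. -/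

import Mathlib

namespace Pesp

/-- The arcs of a digraph `G`: the ordered pairs `(i, j)` with `G.Adj i j`. -/
def Arc {V : Type*} (G : Digraph V) : Type _ := {e : V × V // G.Adj e.1 e.2}

namespace Arc

variable {V : Type*} {G : Digraph V}

/-- The start vertex of an arc. -/
def tail (a : Arc G) : V := a.1.1

/-- The end vertex of an arc. -/
def head (a : Arc G) : V := a.1.2

end Arc

noncomputable instance {V : Type*} [Finite V] (G : Digraph V) : Fintype (Arc G) :=
  haveI : Finite (Arc G) := inferInstanceAs (Finite {e : V × V // G.Adj e.1 e.2})
  Fintype.ofFinite _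

/-- `G` is simple (no loops; a `Digraph` never has parallel arcs) and has no pair of
antiparallel arcs. -/
def IsSimpleOriented {V : Type*} (G : Digraph V) : Prop :=
  (∀ i, ¬ G.Adj i i) ∧ ∀ i j, G.Adj i j → ¬ G.Adj j i

/-- The undirected graph on the whole vertex set whose edges are the arcs in `S`,
with directions forgotten. -/
def arcGraph {V : Type*} {G : Digraph V} (S : Set (Arc G)) : SimpleGraph V :=
  SimpleGraph.fromRel fun i j => ∃ a ∈ S, a.tail = i ∧ a.head = j

/-- The arc set `S` is a (connected) spanning subgraph of `G`. -/
def IsSpanning {V : Type*} {G : Digraph V} (S : Set (Arc G)) : Prop :=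
  (arcGraph S).Connected

/-- The arc set `S` is a spanning tree of `G`. -/
def IsSpanningTree {V : Type*} {G : Digraph V} (S : Set (Arc G)) : Prop :=
  (arcGraph S).IsTree

/-- The set of all spanning trees of `G`, each given by its set of arcs. -/
def spanningTrees {V : Type*} (G : Digraph V) : Set (Set (Arc G)) :=
  {S | IsSpanningTree S}

open Classical in
/-- The incidence matrix: the column of the arc `(i, j)` has `1` in row `i` and `-1` in row `j`. -/
noncomputable def incidenceMatrix {V : Type*} (G : Digraph V) : Matrix V (Arc G) ℤ :=
  Matrix.of fun v a => (if a.tail = v then 1 else 0) - (if a.head = v then 1 else 0)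

/-- An oriented cycle: a `{-1, 0, 1}`-vector in the kernel of the incidence matrix. -/
def IsOrientedCycle {V : Type*} [Finite V] {G : Digraph V} (γ : Arc G → ℤ) : Prop :=
  (∀ a, γ a = -1 ∨ γ a = 0 ∨ γ a = 1) ∧ (incidenceMatrix G).mulVec γ = 0

/-- The cycle space: the subgroup of `ℤ ^ A(G)` generated by the oriented cycles. -/
def cycleSpace {V : Type*} [Finite V] (G : Digraph V) : Submodule ℤ (Arc G → ℤ) :=
  Submodule.span ℤ {γ | IsOrientedCycle γ}

/-- The cyclomatic number: the rank of the cycle space. -/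
noncomputable def cyclomaticNumber {V : Type*} [Finite V] (G : Digraph V) : ℕ :=
  Module.finrank ℤ (cycleSpace G)

/-- The matrix `Γ`, with rows `γ₁, …, γ_μ`, is the cycle matrix of an integral cycle basis:
its rows are `μ` oriented cycles that generate the cycle space over `ℤ`. -/
def IsCycleMatrix {V : Type*} [Finite V] {G : Digraph V}
    (Γ : Matrix (Fin (cyclomaticNumber G)) (Arc G) ℤ) : Prop :=
  (∀ i, IsOrientedCycle (Γ i)) ∧ Submodule.span ℤ (Set.range fun i => Γ i) = cycleSpace G

/-- A PESP instance `(G, T, ℓ, u, w)` on the vertex set `V`. -/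
structure Instance (V : Type*) where
  /-- the directed graph -/
  graph : Digraph V
  /-- the period -/
  period : ℕ
  period_pos : 0 < period
  /-- the lower bounds -/
  lower : Arc graph → ℝ
  /-- the upper bounds -/
  upper : Arc graph → ℝ
  /-- the arc weights -/
  weight : Arc graph → ℝ

namespace Instance

variable {V : Type*} (I : Instance V)

/-- `x` is a periodic tension: it is associated to some periodic timetable `π`, i.e.
`x_a ≡ π_j - π_i` modulo `T` for all arcs `a = (i, j)`. -/
def IsPeriodicTension (x : Arc I.graph → ℝ) : Prop :=
  ∃ (π : V → ℝ) (p : Arc I.graph → ℤ), ∀ a,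
    x a = π a.head - π a.tail + (I.period : ℝ) * (p a : ℝ)

/-- `x` is a feasible periodic tension. -/
def IsFeasible (x : Arc I.graph → ℝ) : Prop :=
  I.IsPeriodicTension x ∧ ∀ a, I.lower a ≤ x a ∧ x a ≤ I.upper a

/-- All arcs are free. -/
def IsFree : Prop := ∀ a, I.upper a - I.lower a = (I.period : ℝ) - 1

/-- All lower and upper bounds are integers. -/
def IsIntegral : Prop :=
  ∀ a, (∃ k : ℤ, I.lower a = (k : ℝ)) ∧ ∃ k : ℤ, I.upper a = (k : ℝ)

/-- The cycle offset zonotope for the cycle matrix `Γ`. -/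
def zonotope [Finite V] (Γ : Matrix (Fin (cyclomaticNumber I.graph)) (Arc I.graph) ℤ) :
    Set (Fin (cyclomaticNumber I.graph) → ℝ) :=
  {z | ∃ x : Arc I.graph → ℝ,
    (Γ.map (fun k : ℤ => (k : ℝ))).mulVec x = (I.period : ℝ) • z ∧
      ∀ a, I.lower a ≤ x a ∧ x a ≤ I.upper a}

/-- The integer points of the cycle offset zonotope. -/
def integerPoints [Finite V]
    (Γ : Matrix (Fin (cyclomaticNumber I.graph)) (Arc I.graph) ℤ) :
    Set (Fin (cyclomaticNumber I.graph) → ℤ) :=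
  {z | (fun i => (z i : ℝ)) ∈ I.zonotope Γ}

end Instance

/-- A structure `(S, L, U)`: arc sets such that `S` is the disjoint union of `L` and `U`. -/
structure ArcStructure {V : Type*} (G : Digraph V) where
  S : Set (Arc G)
  L : Set (Arc G)
  U : Set (Arc G)
  eq_union : S = L ∪ U
  inter_eq_empty : L ∩ U = ∅

/-- There is a feasible solution for the structure `(S, L, U)`: a feasible periodic tension that
attains the lower bounds on `L` and the upper bounds on `U`. -/
def ArcStructure.HasFeasibleSolution {V : Type*} (I : Instance V)
    (σ : ArcStructure I.graph) : Prop :=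
  ∃ x, I.IsFeasible x ∧ (∀ a ∈ σ.L, x a = I.lower a) ∧ ∀ a ∈ σ.U, x a = I.upper a

/-- No degeneracy: all spanning structures for which a feasible solution exists are spanning
tree structures. -/
def Instance.IsNondegenerate {V : Type*} (I : Instance V) : Prop :=
  ∀ σ : ArcStructure I.graph, IsSpanning σ.S → σ.HasFeasibleSolution I → IsSpanningTree σ.S

end Pesp

namespace Pesp

variable {V : Type*} {G : Digraph V}

/-! An integer point `z` is a class of integral offset vectors `p` modulo coboundaries that admits
an integral feasible timetable: `Γ` is onto over `ℤ` and its kernel consists of the coboundaries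
(`IsCycleMatrix.mulVec_surjective`, `IsCycleMatrix.mulVec_eq_iff`), and flooring a real potential
preserves integral difference bounds (`mem_integerPoints_iff`). It remains to match these classes
with spanning trees.

Fix a root `r`. For given `p`, the least feasible timetable with prescribed value at `r` is one in
which tight bounds lead from `r` to every vertex (`exists_isReached`, `IsReached.le`). Its tight
arcs span, so by nondegeneracy they form a tree, which depends only on the class of `p`
(`IsReached.tightArcs_eq`).

Conversely, propagate lower bounds along tree arcs pointing away from `r`, and upper bounds against
those pointing towards it. As arcs are free, any integral timetable becomes feasible with suitable
offsets (`exists_offset`). The result is reached from `r` and its tight arcs are exactly the given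
tree (`exists_isReached_of_isSpanningTree`, plus nondegeneracy). The tree fixes the timetable modulo
`T` up to a constant, hence the class of `p` (`IsReached.offset_eq`). -/

theorem Arc.adj_toSimpleGraphInclusive (hs : IsSimpleOriented G) (a : Arc G) :
    G.toSimpleGraphInclusive.Adj a.tail a.head := by
  refine (SimpleGraph.fromRel_adj _ _ _).2 ⟨fun h => hs.1 a.tail ?_, Or.inl a.2⟩
  have := a.2
  unfold tail head at *
  rwa [← h] at this

theorem Arc.ext {a b : Arc G} (h₁ : a.tail = b.tail) (h₂ : a.head = b.head) : a = b :=
  Subtype.ext (Prod.ext h₁ h₂)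

/-! ### Signed incidence vectors of steps and walks -/

open Classical in
/-- The signed characteristic vector of the step from `u` to `v`. -/
noncomputable def stepVector (G : Digraph V) (u v : V) (a : Arc G) : ℤ :=
  (if a.tail = u ∧ a.head = v then 1 else 0) - (if a.tail = v ∧ a.head = u then 1 else 0)

theorem stepVector_swap (u v : V) : stepVector G v u = -stepVector G u v := by
  funext a
  simp [stepVector]

theorem stepVector_mem (u v : V) (a : Arc G) :
    stepVector G u v a = -1 ∨ stepVector G u v a = 0 ∨ stepVector G u v a = 1 := by
  unfold stepVector
  split_ifs <;> simp

theorem stepVector_eq_zero {u v : V} {a : Arc G} (h : s(a.tail, a.head) ≠ s(u, v)) :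
    stepVector G u v a = 0 := by
  have h' := h
  simp only [ne_eq, Sym2.eq_iff, not_or] at h'
  simp [stepVector, h'.1, h'.2]

theorem stepVector_arc [DecidableEq (Arc G)] (hs : IsSimpleOriented G) (a b : Arc G) :
    stepVector G a.tail a.head b = if b = a then 1 else 0 := by
  classical
  have h₂ : ¬ (b.tail = a.head ∧ b.head = a.tail) := fun h => hs.2 _ _ a.2 (by
    have := b.2
    rwa [show b.1.1 = a.head from h.1, show b.1.2 = a.tail from h.2] at this)
  have h₁ : (b.tail = a.tail ∧ b.head = a.head) ↔ b = a :=
    ⟨fun h => Arc.ext h.1 h.2, fun h => h ▸ ⟨rfl, rfl⟩⟩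
  simp [stepVector, h₁, h₂]

/-- The signed incidence vector of a walk. -/
noncomputable def walkVector {H : SimpleGraph V} : {u v : V} → H.Walk u v → Arc G → ℤ
  | _, _, .nil => 0
  | u, _, .cons (v := v) _ p => stepVector G u v + walkVector p

section walkVector

variable {H : SimpleGraph V}

@[simp] theorem walkVector_nil (u : V) :
    walkVector (G := G) (SimpleGraph.Walk.nil : H.Walk u u) = 0 := rfl

@[simp] theorem walkVector_cons {u v w : V} (h : H.Adj u v) (p : H.Walk v w) :
    walkVector (G := G) (.cons h p) = stepVector G u v + walkVector p := rfl

theorem walkVector_append {u v w : V} (p : H.Walk u v) (q : H.Walk v w) :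
    walkVector (G := G) (p.append q) = walkVector p + walkVector q := by
  induction p with
  | nil => simp
  | cons h p ih => simp [ih, add_assoc]

theorem walkVector_reverse {u v : V} (p : H.Walk u v) :
    walkVector (G := G) p.reverse = -walkVector p := by
  induction p with
  | nil => simp
  | @cons u v _ h p ih =>
    rw [SimpleGraph.Walk.reverse_cons, walkVector_append, ih, walkVector_cons, walkVector_cons,
      walkVector_nil, stepVector_swap u v]
    abel

theorem walkVector_eq_zero {u v : V} (p : H.Walk u v) {a : Arc G}
    (h : s(a.tail, a.head) ∉ p.edges) : walkVector p a = 0 := by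
  induction p with
  | nil => simp
  | cons h' p ih =>
    simp only [SimpleGraph.Walk.edges_cons, List.mem_cons, not_or] at h
    simp [ih h.2, stepVector_eq_zero h.1]

theorem walkVector_mem {u v : V} (p : H.Walk u v) (hp : p.IsTrail) (a : Arc G) :
    walkVector p a = -1 ∨ walkVector p a = 0 ∨ walkVector p a = 1 := by
  induction p with
  | nil => simp
  | cons h' p ih =>
    rw [SimpleGraph.Walk.isTrail_cons] at hp
    rw [walkVector_cons, Pi.add_apply]
    by_cases ha : s(a.tail, a.head) ∈ p.edges
    · rw [stepVector_eq_zero (fun h => hp.2 (h ▸ ha)), zero_add]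
      exact ih hp.1
    · rw [walkVector_eq_zero p ha, add_zero]
      exact stepVector_mem _ _ a

end walkVector

/-! ### Cycle space and coboundaries -/

section Finite

variable [Finite V]

theorem sum_stepVector_mul {R : Type*} [CommRing R] {u v : V}
    (hs : IsSimpleOriented G) (h : G.toSimpleGraphInclusive.Adj u v) (q : V → R) :
    ∑ a : Arc G, (stepVector G u v a : R) * (q a.head - q a.tail) = q v - q u := by
  classical
  have key : ∀ {u v : V} (huv : G.Adj u v),
      ∑ a : Arc G, (stepVector G u v a : R) * (q a.head - q a.tail) = q v - q u := by
    intro u v huv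
    obtain ⟨e, rfl, rfl⟩ : ∃ e : Arc G, e.tail = u ∧ e.head = v := ⟨⟨(u, v), huv⟩, rfl, rfl⟩
    simp [stepVector_arc hs]
  rcases ((SimpleGraph.fromRel_adj _ _ _).1 h).2 with h | h
  · exact key h
  · have := key h
    rw [stepVector_swap] at this
    simp only [Pi.neg_apply, Int.cast_neg, neg_mul, Finset.sum_neg_distrib] at this
    linear_combination -this

theorem sum_walkVector_mul {R : Type*} [CommRing R] {u v : V} (hs : IsSimpleOriented G)
    (p : G.toSimpleGraphInclusive.Walk u v) (q : V → R) :
    ∑ a : Arc G, (walkVector p a : R) * (q a.head - q a.tail) = q v - q u := by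
  induction p with
  | nil => simp
  | cons h p ih =>
    simp only [walkVector_cons, Pi.add_apply, Int.cast_add, add_mul, Finset.sum_add_distrib, ih,
      sum_stepVector_mul hs h]
    ring

theorem incidenceMatrix_mulVec (γ : Arc G → ℤ) (v : V) :
    (incidenceMatrix G).mulVec γ v
      = -∑ a, γ a * ((Set.indicator {v} 1 a.head : ℤ) - (Set.indicator {v} 1 a.tail : ℤ)) := by
  classical
  simp only [incidenceMatrix, Matrix.mulVec, dotProduct, Matrix.of_apply, Set.indicator_apply,
    Set.mem_singleton_iff, Pi.one_apply, ← Finset.sum_neg_distrib]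
  exact Finset.sum_congr rfl fun a _ => by ring

/-- Expanding `q` in vertex indicators turns the sum into a combination of rows of the incidence
equation. -/
theorem sum_mul_coboundary {R : Type*} [CommRing R] {γ : Arc G → ℤ}
    (h : (incidenceMatrix G).mulVec γ = 0) (q : V → R) :
    ∑ a : Arc G, (γ a : R) * (q a.head - q a.tail) = 0 := by
  classical
  have := Fintype.ofFinite V
  have h₁ : ∀ v, ∑ a, (γ a : R) * ((if a.head = v then 1 else 0) - (if a.tail = v then 1 else 0))
      = 0 := by
    intro v
    have := congrArg (Int.cast : ℤ → R) (congrFun h v)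
    rw [incidenceMatrix_mulVec] at this
    simpa [Set.indicator_apply] using this
  have h₂ : ∀ w, q w = ∑ v, q v * (if w = v then 1 else 0) := by simp
  calc ∑ a : Arc G, (γ a : R) * (q a.head - q a.tail)
      = ∑ a : Arc G, ∑ v, q v *
        ((γ a : R) * ((if a.head = v then 1 else 0) - (if a.tail = v then 1 else 0))) := by
        refine Finset.sum_congr rfl fun a _ => ?_
        rw [h₂ a.head, h₂ a.tail, ← Finset.sum_sub_distrib, Finset.mul_sum]
        exact Finset.sum_congr rfl fun v _ => by ring
    _ = 0 := by
        rw [Finset.sum_comm]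
        refine Finset.sum_eq_zero fun v _ => ?_
        rw [← Finset.mul_sum, h₁, mul_zero]

theorem walkVector_isOrientedCycle (hs : IsSimpleOriented G) {u : V}
    (p : G.toSimpleGraphInclusive.Walk u u) (hp : p.IsTrail) :
    IsOrientedCycle (walkVector (G := G) p) := by
  refine ⟨walkVector_mem p hp, funext fun v => ?_⟩
  have := sum_walkVector_mul hs p (Set.indicator {v} (1 : V → ℤ))
  simp only [Int.cast_id, sub_self] at this
  rw [incidenceMatrix_mulVec, this]
  simp

/-- An edge closing up a path gives a trail, unless the path is that same edge traversed backwards;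
then the two steps cancel. -/
theorem walkVector_cons_mem_cycleSpace (hs : IsSimpleOriented G) {u v : V}
    (h : G.toSimpleGraphInclusive.Adj u v) (p : G.toSimpleGraphInclusive.Walk v u)
    (hp : p.IsPath) : walkVector (G := G) (.cons h p) ∈ cycleSpace G := by
  by_cases he : s(u, v) ∈ p.edges
  · have : walkVector (G := G) (.cons h p) = 0 := by
      cases p with
      | nil => exact absurd rfl h.ne
      | @cons _ w _ h' p =>
        rw [SimpleGraph.Walk.cons_isPath_iff] at hp
        rw [SimpleGraph.Walk.edges_cons, List.mem_cons] at he
        rcases he with he | he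
        · have hw : w = u := by
            rcases Sym2.eq_iff.1 he with h₁ | h₁
            · exact absurd h₁.1 h.ne
            · exact h₁.1.symm
          subst hw
          have := SimpleGraph.Walk.eq_nil_iff_nil.2 (SimpleGraph.Walk.isPath_iff_nil.1 hp.1)
          subst this
          simp [stepVector_swap w v]
        · exact absurd (p.snd_mem_support_of_mem_edges he) hp.2
    rw [this]
    exact zero_mem _
  · exact Submodule.subset_span
      (walkVector_isOrientedCycle hs _ (SimpleGraph.Walk.isTrail_cons _ _ |>.2 ⟨hp.isTrail, he⟩))

/-- Loop erasure: each removed piece is an edge closing up a path. -/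
theorem exists_isPath_walkVector_sub_mem (hs : IsSimpleOriented G) {u v : V}
    (p : G.toSimpleGraphInclusive.Walk u v) :
    ∃ q : G.toSimpleGraphInclusive.Walk u v, q.IsPath ∧
      walkVector (G := G) p - walkVector q ∈ cycleSpace G := by
  classical
  induction p with
  | nil => exact ⟨.nil, by simp, by simp⟩
  | @cons u v w h p ih =>
    obtain ⟨q, hq, hpq⟩ := ih
    by_cases hu : u ∈ q.support
    · refine ⟨q.dropUntil u hu, hq.dropUntil hu, ?_⟩
      have h₁ := walkVector_cons_mem_cycleSpace hs h (q.takeUntil u hu) (hq.takeUntil hu)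
      have h₂ : walkVector (G := G) q
          = walkVector (q.takeUntil u hu) + walkVector (q.dropUntil u hu) := by
        rw [← walkVector_append, q.take_spec]
      have := add_mem hpq h₁
      rw [h₂, walkVector_cons] at this
      rw [walkVector_cons]
      convert this using 1
      abel
    · exact ⟨.cons h q, hq.cons hu, by simpa using hpq⟩

theorem walkVector_mem_cycleSpace (hs : IsSimpleOriented G) {u : V}
    (p : G.toSimpleGraphInclusive.Walk u u) : walkVector (G := G) p ∈ cycleSpace G := by
  obtain ⟨q, hq, h⟩ := exists_isPath_walkVector_sub_mem hs p
  rw [SimpleGraph.Walk.eq_nil_iff_nil.2 (SimpleGraph.Walk.isPath_iff_nil.1 hq)] at h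
  simpa using h

/-- For each vertex an integral vector such that the associated fundamental vectors of the arcs
lie in the cycle space. -/
theorem exists_fundamental (hs : IsSimpleOriented G) (hc : G.toSimpleGraphInclusive.Connected) :
    ∃ P : V → Arc G → ℤ, ∀ a : Arc G,
      stepVector G a.tail a.head + P a.tail - P a.head ∈ cycleSpace G := by
  obtain ⟨r⟩ := hc.nonempty
  have w : ∀ v, G.toSimpleGraphInclusive.Walk r v := fun v => (hc.preconnected r v).some
  refine ⟨fun v => walkVector (w v), fun a => ?_⟩
  have := walkVector_mem_cycleSpace hs
    ((w a.tail).append (.cons (a.adj_toSimpleGraphInclusive hs) (w a.head).reverse))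
  rw [walkVector_append, walkVector_cons, walkVector_reverse] at this
  convert this using 1
  abel

/-- A vector orthogonal to all oriented cycles is the coboundary of a potential. -/
theorem exists_potential {R : Type*} [CommRing R] (hs : IsSimpleOriented G)
    (hc : G.toSimpleGraphInclusive.Connected) (x : Arc G → R)
    (hx : ∀ γ ∈ cycleSpace G, ∑ a, (γ a : R) * x a = 0) :
    ∃ q : V → R, ∀ a : Arc G, x a = q a.head - q a.tail := by
  classical
  obtain ⟨P, hP⟩ := exists_fundamental hs hc
  refine ⟨fun v => ∑ a, (P v a : R) * x a, fun a => ?_⟩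
  have := hx _ (hP a)
  simp only [Pi.add_apply, Pi.sub_apply, Int.cast_add, Int.cast_sub, sub_mul, add_mul,
    Finset.sum_add_distrib, Finset.sum_sub_distrib, stepVector_arc hs] at this
  simp at this
  linear_combination this

/-! ### The integral cycle matrix -/

section IsCycleMatrix

variable {Γ : Matrix (Fin (cyclomaticNumber G)) (Arc G) ℤ}

theorem IsCycleMatrix.linearIndependent (hΓ : IsCycleMatrix Γ) :
    LinearIndependent ℤ (fun i => Γ i) := by
  rw [linearIndependent_iff_card_eq_finrank_span, Set.finrank, hΓ.2, Fintype.card_fin]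
  rfl

/-- The cycle space is a direct summand of `ℤ ^ A(G)`: mapping each unit vector to its fundamental
vector is a retraction, as the `P`-terms cancel along cycles. The functional with value `z i` on the
`i`-th basis cycle therefore extends to all integral vectors. -/
theorem IsCycleMatrix.mulVec_surjective (hΓ : IsCycleMatrix Γ) (hs : IsSimpleOriented G)
    (hc : G.toSimpleGraphInclusive.Connected) : Function.Surjective Γ.mulVec := by
  classical
  intro z
  obtain ⟨P, hP⟩ := exists_fundamental hs hc
  let b := Module.Basis.span hΓ.linearIndependent
  let L := b.constr ℤ z
  have hb : ∀ i, (b i : Arc G → ℤ) = Γ i := fun i => by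
    rw [Module.Basis.span_apply]
  have hP' : ∀ a : Arc G, stepVector G a.tail a.head + P a.tail - P a.head ∈
      Submodule.span ℤ (Set.range fun i => Γ i) := fun a => hΓ.2 ▸ hP a
  refine ⟨fun a => L ⟨_, hP' a⟩, funext fun i => ?_⟩
  have h : ∑ a, Γ i a • (⟨_, hP' a⟩ : Submodule.span ℤ (Set.range fun i => Γ i)) = b i := by
    apply Subtype.ext
    rw [hb]
    funext c
    have := sum_mul_coboundary (R := ℤ) (hΓ.1 i).2 (fun v => P v c)
    simp only [Int.cast_id] at this
    have h' : ∑ a : Arc G, Γ i a * stepVector G a.tail a.head c = Γ i c := by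
      simp [stepVector_arc hs]
    simp only [Submodule.coe_sum, Submodule.coe_smul, Finset.sum_apply, Pi.smul_apply,
      Pi.add_apply, Pi.sub_apply, smul_eq_mul]
    calc _ = ∑ a : Arc G, Γ i a * stepVector G a.tail a.head c
          - ∑ a : Arc G, Γ i a * (P a.head c - P a.tail c) := by
          rw [← Finset.sum_sub_distrib]
          exact Finset.sum_congr rfl fun a _ => by ring
      _ = _ := by linear_combination h' - this
  have h₂ := congrArg L h
  rw [map_sum, b.constr_basis] at h₂
  simp only [map_smul, smul_eq_mul] at h₂
  exact h₂

theorem IsCycleMatrix.sum_mul_eq_zero {R : Type*} [CommRing R] (hΓ : IsCycleMatrix Γ)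
    {x : Arc G → R} (hx : (Γ.map (fun k : ℤ => (k : R))).mulVec x = 0) :
    ∀ γ ∈ cycleSpace G, ∑ a, (γ a : R) * x a = 0 := by
  intro γ hγ
  rw [← hΓ.2] at hγ
  induction hγ using Submodule.span_induction with
  | mem γ hγ =>
    obtain ⟨i, rfl⟩ := hγ
    simpa [Matrix.mulVec, dotProduct] using congrFun hx i
  | zero => simp
  | add γ δ _ _ h₁ h₂ => simp [add_mul, Finset.sum_add_distrib, h₁, h₂]
  | smul k γ _ h => simp [mul_assoc, ← Finset.mul_sum, h]

theorem IsCycleMatrix.exists_potential {R : Type*} [CommRing R] (hΓ : IsCycleMatrix Γ)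
    (hs : IsSimpleOriented G) (hc : G.toSimpleGraphInclusive.Connected)
    {x : Arc G → R} (hx : (Γ.map (fun k : ℤ => (k : R))).mulVec x = 0) :
    ∃ q : V → R, ∀ a : Arc G, x a = q a.head - q a.tail :=
  Pesp.exists_potential hs hc x (hΓ.sum_mul_eq_zero hx)

theorem IsCycleMatrix.mulVec_coboundary {R : Type*} [CommRing R] (hΓ : IsCycleMatrix Γ)
    (q : V → R) :
    (Γ.map (fun k : ℤ => (k : R))).mulVec (fun a : Arc G => q a.head - q a.tail) = 0 := by
  funext i
  simpa [Matrix.mulVec, dotProduct] using sum_mul_coboundary (hΓ.1 i).2 q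

end IsCycleMatrix

end Finite

/-! ### Least timetables and their tight arcs -/

/-- Integral timetables `π` with offsets `p` satisfying the bounds `l ≤ x ≤ l + T - 1` for the
tension `x a = π j - π i + T * p a`. -/
def IsFeasiblePair (l : Arc G → ℤ) (T : ℤ) (π : V → ℤ) (p : Arc G → ℤ) : Prop :=
  ∀ a, l a ≤ π a.head - π a.tail + T * p a ∧ π a.head - π a.tail + T * p a ≤ l a + T - 1

/-- The arcs whose lower or upper bound is attained. -/
def tightArcs (l : Arc G → ℤ) (T : ℤ) (π : V → ℤ) (p : Arc G → ℤ) : Set (Arc G) :=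
  {a | π a.head - π a.tail + T * p a = l a ∨ π a.head - π a.tail + T * p a = l a + T - 1}

/-- `TightStep i j` holds if some bound prevents the potential of `j` from being decreased relative
to that of `i`. -/
def TightStep (l : Arc G → ℤ) (T : ℤ) (π : V → ℤ) (p : Arc G → ℤ) (i j : V) : Prop :=
  ∃ a : Arc G, (a.tail = i ∧ a.head = j ∧ π a.head - π a.tail + T * p a = l a) ∨
    (a.tail = j ∧ a.head = i ∧ π a.head - π a.tail + T * p a = l a + T - 1)

/-- All vertices are reachable from `r` by tight steps. -/
def IsReached (l : Arc G → ℤ) (T : ℤ) (r : V) (π : V → ℤ) (p : Arc G → ℤ) : Prop :=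
  ∀ v, Relation.ReflTransGen (TightStep l T π p) r v

section Timetables

variable {l : Arc G → ℤ} {T : ℤ} {r : V} {π π' : V → ℤ} {p p' : Arc G → ℤ}

theorem arcGraph_adj (hs : IsSimpleOriented G) {S : Set (Arc G)} {i j : V} :
    (arcGraph S).Adj i j ↔
      ∃ a ∈ S, (a.tail = i ∧ a.head = j) ∨ (a.tail = j ∧ a.head = i) := by
  refine (SimpleGraph.fromRel_adj _ _ _).trans ⟨?_, ?_⟩
  · rintro ⟨-, ⟨a, ha, h⟩ | ⟨a, ha, h⟩⟩
    exacts [⟨a, ha, Or.inl h⟩, ⟨a, ha, Or.inr h⟩]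
  · rintro ⟨a, ha, h⟩
    have hne := (a.adj_toSimpleGraphInclusive hs).ne
    rcases h with ⟨rfl, rfl⟩ | ⟨rfl, rfl⟩
    exacts [⟨hne, Or.inl ⟨a, ha, rfl, rfl⟩⟩, ⟨hne.symm, Or.inr ⟨a, ha, rfl, rfl⟩⟩]

theorem Arc.eq_of_sym2_eq (hs : IsSimpleOriented G) {a b : Arc G}
    (h : s(a.tail, a.head) = s(b.tail, b.head)) : a = b := by
  rcases Sym2.eq_iff.1 h with h | h
  · exact Arc.ext h.1 h.2
  · refine absurd a.2 (hs.2 _ _ ?_)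
    have := b.2
    rwa [show b.1.1 = a.head from h.2.symm, show b.1.2 = a.tail from h.1.symm] at this

theorem arcGraph_injective (hs : IsSimpleOriented G) :
    Function.Injective (arcGraph : Set (Arc G) → SimpleGraph V) := by
  have key : ∀ {S S' : Set (Arc G)}, arcGraph S = arcGraph S' → S ⊆ S' := by
    intro S S' h a ha
    have : (arcGraph S).Adj a.tail a.head := (arcGraph_adj hs).2 ⟨a, ha, Or.inl ⟨rfl, rfl⟩⟩
    rw [h, arcGraph_adj hs] at this
    obtain ⟨b, hb, hab⟩ := this
    rwa [Arc.eq_of_sym2_eq hs (Sym2.eq_iff.2 hab)] at hb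
  exact fun S S' h => (key h).antisymm (key h.symm)

theorem arcGraph_mono (hs : IsSimpleOriented G) :
    Monotone (arcGraph : Set (Arc G) → SimpleGraph V) := by
  intro S S' h i j hij
  obtain ⟨a, ha, hij⟩ := (arcGraph_adj hs).1 hij
  exact (arcGraph_adj hs).2 ⟨a, h ha, hij⟩

theorem TightStep.adj (hs : IsSimpleOriented G) {i j : V} (h : TightStep l T π p i j) :
    (arcGraph (tightArcs l T π p)).Adj i j := by
  obtain ⟨a, h | h⟩ := h
  · exact (arcGraph_adj hs).2 ⟨a, Or.inl h.2.2, Or.inl ⟨h.1, h.2.1⟩⟩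
  · exact (arcGraph_adj hs).2 ⟨a, Or.inr h.2.2, Or.inr ⟨h.1, h.2.1⟩⟩

theorem connected_of_reachable {H : SimpleGraph V} (h : ∀ v, H.Reachable r v) : H.Connected :=
  { preconnected := fun u v => (h u).symm.trans (h v), nonempty := ⟨r⟩ }

theorem IsReached.connected (hs : IsSimpleOriented G) (h : IsReached l T r π p) :
    (arcGraph (tightArcs l T π p)).Connected := by
  refine connected_of_reachable (r := r) fun v => ?_
  have := h v
  induction this with
  | refl => exact .refl _
  | tail _ h₂ ih => exact ih.trans (h₂.adj hs).reachable

/-- Reached potentials are componentwise least. -/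
theorem IsReached.le (h : IsReached l T r π p) (hf : IsFeasiblePair l T π' p)
    (hr : π r ≤ π' r) (v : V) : π v ≤ π' v := by
  have := h v
  induction this with
  | refl => exact hr
  | tail _ h₂ ih =>
    obtain ⟨a, ⟨rfl, rfl, h₃⟩ | ⟨rfl, rfl, h₃⟩⟩ := h₂
    · have := (hf a).1
      omega
    · have := (hf a).2
      omega

theorem exists_lower_bound (hc : G.toSimpleGraphInclusive.Connected) (l : Arc G → ℤ) (T : ℤ)
    (p : Arc G → ℤ) (r : V) (c : ℤ) (v : V) :
    ∃ B : ℤ, ∀ π : V → ℤ, IsFeasiblePair l T π p → π r = c → B ≤ π v := by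
  have := (SimpleGraph.reachable_iff_reflTransGen _ _).1 (hc.preconnected r v)
  induction this with
  | refl => exact ⟨c, fun π _ h => h.ge⟩
  | @tail i j _ h₂ ih =>
    obtain ⟨B, hB⟩ := ih
    rcases ((SimpleGraph.fromRel_adj _ _ _).1 h₂).2 with h | h
    · obtain ⟨a, rfl, rfl⟩ : ∃ a : Arc G, a.tail = i ∧ a.head = j := ⟨⟨(i, j), h⟩, rfl, rfl⟩
      refine ⟨B + l a - T * p a, fun π hπ hr => ?_⟩
      have := (hπ a).1
      have := hB π hπ hr
      omega
    · obtain ⟨a, rfl, rfl⟩ : ∃ a : Arc G, a.tail = j ∧ a.head = i := ⟨⟨(j, i), h⟩, rfl, rfl⟩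
      refine ⟨B - (l a + T - 1) + T * p a, fun π hπ hr => ?_⟩
      have := (hπ a).2
      have := hB π hπ hr
      omega

theorem exists_isReached [Finite V] (hc : G.toSimpleGraphInclusive.Connected) (r : V)
    (hf : IsFeasiblePair l T π p) : ∃ π', IsFeasiblePair l T π' p ∧ IsReached l T r π' p := by
  classical
  have := Fintype.ofFinite V
  choose B hB using exists_lower_bound hc l T p r (π r)
  let s : Set (V → ℤ) := {π' | IsFeasiblePair l T π' p ∧ π' r = π r}
  -- The bounds `B` keep the sum nonnegative on `s`, so `toNat` loses nothing there.
  obtain ⟨π', ⟨hf', hr'⟩, hmin⟩ := WellFounded.has_min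
    (measure fun π' : V → ℤ => (∑ v, (π' v - B v)).toNat).wf s ⟨π, hf, rfl⟩
  refine ⟨π', hf', ?_⟩
  by_contra hnot
  simp only [IsReached, not_forall] at hnot
  obtain ⟨w, hw⟩ := hnot
  let R := Relation.ReflTransGen (TightStep l T π' p) r
  -- Lowering all unreached vertices by one stays feasible: no bound across the cut is tight in the
  -- blocking direction, and by integrality its slack is at least one.
  let π'' : V → ℤ := fun v => if R v then π' v else π' v - 1
  have hR : R r := Relation.ReflTransGen.refl
  have hs : π'' ∈ s := by
    refine ⟨fun a => ?_, by simp [π'', hR, hr']⟩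
    have h₁ := hf' a
    by_cases ht : R a.tail <;> by_cases hh : R a.head
    · simpa [π'', ht, hh] using h₁
    · have : π' a.head - π' a.tail + T * p a ≠ l a := fun h =>
        hh (Relation.ReflTransGen.tail ht ⟨a, Or.inl ⟨rfl, rfl, h⟩⟩)
      simp only [π'', ht, hh, if_true, if_false]
      omega
    · have : π' a.head - π' a.tail + T * p a ≠ l a + T - 1 := fun h =>
        ht (Relation.ReflTransGen.tail hh ⟨a, Or.inr ⟨rfl, rfl, h⟩⟩)
      simp only [π'', ht, hh, if_true, if_false]
      omega
    · simp only [π'', ht, hh, if_false]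
      omega
  refine hmin π'' hs ?_
  have h₀ : 0 ≤ ∑ v, (π'' v - B v) :=
    Finset.sum_nonneg fun v _ => sub_nonneg.2 (hB v π'' hs.1 hs.2)
  have h₁ : ∑ v, (π'' v - B v) < ∑ v, (π' v - B v) := by
    refine Finset.sum_lt_sum (fun v _ => ?_) ⟨w, Finset.mem_univ _, ?_⟩
    · simp only [π'']
      split_ifs <;> omega
    · have : ¬ R w := hw
      simp [π'', this]
  change (∑ v, (π'' v - B v)).toNat < (∑ v, (π' v - B v)).toNat
  omega

theorem eq_of_abs_mul_lt {T k : ℤ} (h₁ : T * k < T) (h₂ : -T < T * k) : k = 0 := by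
  have hT : 0 < T := by omega
  have h₃ : k < 1 := by nlinarith
  have h₄ : -1 < k := by nlinarith
  omega

/-- If two feasible timetables agree modulo `T`, then their offsets differ by a coboundary. -/
theorem IsFeasiblePair.offset_eq {q : V → ℤ} (h : IsFeasiblePair l T π p)
    (h' : IsFeasiblePair l T π' p') (hq : ∀ v, π' v = π v + T * q v) (a : Arc G) :
    p a - p' a = q a.head - q a.tail := by
  have h₁ := h a
  have h₂ := h' a
  rw [hq, hq] at h₂
  -- Both tensions lie in an interval of length `T - 1`, so a difference divisible by `T` vanishes.
  have h₃ : T * (p' a + (q a.head - q a.tail) - p a)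
    = (π a.head + T * q a.head - (π a.tail + T * q a.tail) + T * p' a)
      - (π a.head - π a.tail + T * p a) := by ring
  have := eq_of_abs_mul_lt (T := T) (k := p' a + (q a.head - q a.tail) - p a)
    (by omega) (by omega)
  omega

theorem exists_offset (hT : 0 < T) (l : Arc G → ℤ) (π : V → ℤ) :
    ∃ p, IsFeasiblePair l T π p := by
  refine ⟨fun a => -((π a.head - π a.tail - l a) / T), fun a => ?_⟩
  have h₁ := Int.emod_add_mul_ediv (π a.head - π a.tail - l a) T
  have h₂ := Int.emod_nonneg (π a.head - π a.tail - l a) hT.ne'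
  have h₃ := Int.emod_lt_of_pos (π a.head - π a.tail - l a) hT
  simp only [mul_neg]
  omega

/-- If offsets differ by a coboundary, then reached solutions have the same tight arcs. -/
theorem IsReached.tightArcs_eq {q : V → ℤ} (h : IsReached l T r π p) (h' : IsReached l T r π' p')
    (hf : IsFeasiblePair l T π p) (hf' : IsFeasiblePair l T π' p')
    (hq : ∀ a : Arc G, p a - p' a = q a.head - q a.tail) :
    tightArcs l T π p = tightArcs l T π' p' := by
  set c := π' r - (π r + T * q r)
  -- `π` rewritten for the offsets `p'` with unchanged tensions; `c` makes it agree with `π'` at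
  -- `r`. Both are then least, hence equal.
  let σ : V → ℤ := fun v => π v + T * q v + c
  have hσ : ∀ a : Arc G, σ a.head - σ a.tail + T * p' a = π a.head - π a.tail + T * p a := by
    intro a
    have : p' a = p a - (q a.head - q a.tail) := by rw [← hq]; ring
    simp only [σ, this]
    ring
  have hσf : IsFeasiblePair l T σ p' := fun a => by rw [hσ]; exact hf a
  have hσs : TightStep l T σ p' = TightStep l T π p := by
    funext i j
    simp only [TightStep, hσ]
  have hσr : IsReached l T r σ p' := by
    intro v
    rw [hσs]
    exact h v
  have hr : σ r = π' r := by simp [σ, c]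
  have : σ = π' := funext fun v => (hσr.le hf' hr.le v).antisymm (h'.le hσf hr.ge v)
  ext a
  simp only [tightArcs, Set.mem_ofPred_eq, ← hσ a, this]

/-! ### Timetables from spanning trees -/

open Classical in
/-- The increment (modulo the period) of a potential along a tight step. -/
noncomputable def increment (l : Arc G → ℤ) (T : ℤ) (i j : V) : ℤ :=
  if h : ∃ a : Arc G, a.tail = i ∧ a.head = j then l h.choose
  else if h : ∃ a : Arc G, a.tail = j ∧ a.head = i then -(l h.choose + T - 1) else 0

theorem increment_forward (l : Arc G → ℤ) (T : ℤ) (a : Arc G) :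
    increment l T a.tail a.head = l a := by
  have h : ∃ b : Arc G, b.tail = a.tail ∧ b.head = a.head := ⟨a, rfl, rfl⟩
  rw [increment, dif_pos h, Arc.ext h.choose_spec.1 h.choose_spec.2]

theorem increment_backward (hs : IsSimpleOriented G) (l : Arc G → ℤ) (T : ℤ) (a : Arc G) :
    increment l T a.head a.tail = -(l a + T - 1) := by
  have h : ∃ b : Arc G, b.tail = a.tail ∧ b.head = a.head := ⟨a, rfl, rfl⟩
  have h' : ¬ ∃ b : Arc G, b.tail = a.head ∧ b.head = a.tail := by
    rintro ⟨b, h₁, h₂⟩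
    have := Arc.eq_of_sym2_eq hs
      (Sym2.eq_iff.2 (Or.inr ⟨h₁, h₂⟩) : s(b.tail, b.head) = s(a.tail, a.head))
    subst this
    exact (b.adj_toSimpleGraphInclusive hs).ne h₁
  rw [increment, dif_neg h', dif_pos h, Arc.ext h.choose_spec.1 h.choose_spec.2]

theorem TightStep.modEq (hs : IsSimpleOriented G) {i j : V} (h : TightStep l T π p i j) :
    ∃ k, π j = π i + increment l T i j + T * k := by
  obtain ⟨a, ⟨rfl, rfl, h⟩ | ⟨rfl, rfl, h⟩⟩ := h
  · exact ⟨-p a, by rw [increment_forward]; linear_combination h⟩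
  · exact ⟨p a, by rw [increment_backward hs]; linear_combination -h⟩

/-- With the exact increment, feasibility confines `T * p a` strictly between `-T` and `T`, so the
offset is zero and the bound is attained. -/
theorem tightStep_of_eq (hs : IsSimpleOriented G) (hf : IsFeasiblePair l T π p) {i j : V}
    {S : Set (Arc G)} (hij : (arcGraph S).Adj i j) (h : π j = π i + increment l T i j) :
    ∃ a ∈ S, a ∈ tightArcs l T π p ∧ s(a.tail, a.head) = s(i, j) ∧ TightStep l T π p i j := by
  obtain ⟨a, ha, ⟨rfl, rfl⟩ | ⟨rfl, rfl⟩⟩ := (arcGraph_adj hs).1 hij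
  · rw [increment_forward] at h
    have h₁ := hf a
    have h₂ := eq_of_abs_mul_lt (T := T) (k := p a) (by omega) (by omega)
    have h₃ : π a.head - π a.tail + T * p a = l a := by rw [h₂, h]; ring
    exact ⟨a, ha, Or.inl h₃, rfl, a, Or.inl ⟨rfl, rfl, h₃⟩⟩
  · rw [increment_backward hs] at h
    have h₁ := hf a
    have h₂ := eq_of_abs_mul_lt (T := T) (k := p a) (by omega) (by omega)
    have h₃ : π a.head - π a.tail + T * p a = l a + T - 1 := by rw [h₂, h]; ring
    exact ⟨a, ha, Or.inr h₃, Sym2.eq_swap, a, Or.inr ⟨rfl, rfl, h₃⟩⟩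

/-- In a tree, every reached solution is obtained by following the unique paths. -/
theorem IsReached.exists_isPath (hs : IsSimpleOriented G) (h : IsReached l T r π p) (v : V) :
    ∃ w : (arcGraph (tightArcs l T π p)).Walk v r, w.IsPath ∧
      ∀ d ∈ w.darts, TightStep l T π p d.snd d.fst := by
  classical
  have := h v
  have : ∃ w : (arcGraph (tightArcs l T π p)).Walk v r,
      ∀ d ∈ w.darts, TightStep l T π p d.snd d.fst := by
    induction this with
    | refl => exact ⟨.nil, by simp⟩
    | tail _ h₂ ih =>
      obtain ⟨w, hw⟩ := ih
      refine ⟨.cons (h₂.adj hs).symm w, fun d hd => ?_⟩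
      rw [SimpleGraph.Walk.darts_cons, List.mem_cons] at hd
      rcases hd with rfl | hd
      exacts [h₂, hw d hd]
  obtain ⟨w, hw⟩ := this
  exact ⟨w.bypass, w.bypass_isPath, fun d hd => hw d (w.darts_bypass_subset_darts hd)⟩

theorem modEq_of_walk (hs : IsSimpleOriented G) {H : SimpleGraph V} {v : V} (w : H.Walk v r)
    (h : ∀ d ∈ w.darts, TightStep l T π p d.snd d.fst)
    (h' : ∀ d ∈ w.darts, TightStep l T π' p' d.snd d.fst) :
    ∃ k, π' v = π v + (π' r - π r) + T * k := by
  induction w with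
  | nil => exact ⟨0, by ring⟩
  | @cons i j _ hij w ih =>
    simp only [SimpleGraph.Walk.darts_cons, List.mem_cons, forall_eq_or_imp] at h h'
    obtain ⟨k, hk⟩ := ih h.2 h'.2
    obtain ⟨k₁, h₁⟩ := h.1.modEq hs
    obtain ⟨k₂, h₂⟩ := h'.1.modEq hs
    exact ⟨k + k₂ - k₁, by linear_combination hk + h₂ - h₁⟩

/-- Reached solutions with the same tree of tight arcs have offsets that differ by a coboundary. -/
theorem IsReached.offset_eq (hs : IsSimpleOriented G) (h : IsReached l T r π p)
    (h' : IsReached l T r π' p') (hf : IsFeasiblePair l T π p) (hf' : IsFeasiblePair l T π' p')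
    (ht : IsSpanningTree (tightArcs l T π p)) (he : tightArcs l T π p = tightArcs l T π' p') :
    ∃ q : V → ℤ, ∀ a : Arc G, p a - p' a = q a.head - q a.tail := by
  have : ∀ v, ∃ k, π' v = π v + (π' r - π r) + T * k := by
    intro v
    obtain ⟨w, hw, h₁⟩ := h.exists_isPath hs v
    obtain ⟨w', hw', h₂⟩ := h'.exists_isPath hs v
    revert w' hw' h₂
    rw [← he]
    intro w' hw' h₂
    -- Uniqueness of tree paths makes both solutions use the same directed tight steps, hence the
    -- same increments modulo `T`.
    obtain rfl := (ht.existsUnique_path v r).unique hw hw'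
    exact modEq_of_walk hs w h₁ h₂
  choose q hq using this
  have hf₂ : IsFeasiblePair l T (fun v => π v + (π' r - π r)) p := fun a => by
    have := hf a
    simp only
    omega
  exact ⟨q, hf₂.offset_eq hf' hq⟩

/-- For every spanning tree there is a reached solution whose tight arcs in the tree span. -/
theorem exists_isReached_of_isSpanningTree (hs : IsSimpleOriented G) (hT : 0 < T) (r : V)
    (l : Arc G → ℤ) {S : Set (Arc G)} (hS : IsSpanningTree S) :
    ∃ π p, IsFeasiblePair l T π p ∧ IsReached l T r π p ∧
      (arcGraph (S ∩ tightArcs l T π p)).Connected := by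
  choose P hP hP' using fun v => hS.existsUnique_path v r
  let f : ∀ {v}, (arcGraph S).Walk v r → ℤ :=
    fun w => (w.darts.map fun d => increment l T d.snd d.fst).sum
  let π : V → ℤ := fun v => f (P v)
  obtain ⟨p, hf⟩ := exists_offset hT l π
  have step : ∀ {i j} (hij : (arcGraph S).Adj i j) (w : (arcGraph S).Walk j r),
      (SimpleGraph.Walk.cons hij w).IsPath →
        TightStep l T π p j i ∧ (arcGraph (S ∩ tightArcs l T π p)).Adj j i := by
    intro i j hij w hw
    have h : π i = π j + increment l T j i := by
      simp only [π, ← hP' i _ hw, ← hP' j _ hw.of_cons, f, SimpleGraph.Walk.darts_cons,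
        List.map_cons, List.sum_cons]
      ring
    obtain ⟨a, haS, hat, he, ht⟩ := tightStep_of_eq hs hf hij.symm h
    exact ⟨ht, (arcGraph_adj hs).2 ⟨a, ⟨haS, hat⟩, Sym2.eq_iff.1 he⟩⟩
  -- The endpoint is kept variable so that induction on the walk applies.
  have key : ∀ {u v} (w : (arcGraph S).Walk v u) (hu : u = r), w.IsPath →
      Relation.ReflTransGen (TightStep l T π p) r v ∧
        (arcGraph (S ∩ tightArcs l T π p)).Reachable r v := by
    intro u v w hu hw
    induction w with
    | nil => exact hu ▸ ⟨.refl, .refl _⟩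
    | cons hij w ih =>
      subst hu
      obtain ⟨h₁, h₂⟩ := ih rfl hw.of_cons
      obtain ⟨h₃, h₄⟩ := step hij w hw
      exact ⟨h₁.tail h₃, h₂.trans h₄.reachable⟩
  exact ⟨π, p, hf, fun v => (key (P v) rfl (hP v)).1,
    connected_of_reachable (r := r) fun v => (key (P v) rfl (hP v)).2⟩

end Timetables

/-! ### Transfer to the PESP instance -/

theorem isSpanningTree_tightArcs {I : Instance V} {l : Arc I.graph → ℤ}
    (hl : ∀ a, I.lower a = l a) (hfree : I.IsFree) (hnondeg : I.IsNondegenerate)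
    {π : V → ℤ} {p : Arc I.graph → ℤ} (hf : IsFeasiblePair l I.period π p)
    (hc : (arcGraph (tightArcs l I.period π p)).Connected) :
    IsSpanningTree (tightArcs l I.period π p) := by
  have hu : ∀ a, I.upper a = ((l a + I.period - 1 : ℤ) : ℝ) := fun a => by
    have := hfree a
    rw [hl] at this
    push_cast
    linarith
  let x : Arc I.graph → ℤ := fun a => π a.head - π a.tail + I.period * p a
  let L : Set (Arc I.graph) := {a | x a = l a}
  -- For period `1` the two bounds coincide; the second condition keeps `L` and `U` disjoint.
  let U : Set (Arc I.graph) := {a | x a = l a + I.period - 1 ∧ x a ≠ l a}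
  have hLU : tightArcs l I.period π p = L ∪ U := by
    ext a
    change (x a = l a ∨ x a = l a + I.period - 1) ↔
      (x a = l a ∨ (x a = l a + I.period - 1 ∧ x a ≠ l a))
    tauto
  refine hnondeg ⟨_, L, U, hLU, ?_⟩ hc ⟨fun a => (x a : ℝ), ⟨⟨fun v => π v, p, fun a => ?_⟩,
    fun a => ?_⟩, fun a ha => ?_, fun a ha => ?_⟩
  · ext a
    simp only [Set.mem_inter_iff, Set.mem_empty_iff_false, iff_false, not_and]
    exact fun h₁ h₂ => h₂.2 h₁
  · simp [x]
  · rw [hl, hu]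
    exact ⟨Int.cast_le.2 (hf a).1, Int.cast_le.2 (hf a).2⟩
  · rw [hl]
    exact congrArg Int.cast ha
  · rw [hu]
    exact congrArg Int.cast ha.1

theorem floor_difference_bounds {s t : ℝ} {m k : ℤ} (h₁ : (m : ℝ) ≤ t - s) (h₂ : t - s ≤ k) :
    m ≤ ⌊t⌋ - ⌊s⌋ ∧ ⌊t⌋ - ⌊s⌋ ≤ k := by
  constructor
  · have : ⌊s + m⌋ ≤ ⌊t⌋ := Int.floor_mono (by linarith)
    rw [Int.floor_add_intCast] at this
    omega
  · have : ⌊t⌋ ≤ ⌊s + k⌋ := Int.floor_mono (by linarith)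
    rw [Int.floor_add_intCast] at this
    omega

variable [Finite V]

/-- Given `x`, choose integral `p` with image `z`; then `x - T p` is killed by `Γ`, so it is a real
coboundary, and flooring its potential keeps the integral bounds. -/
theorem mem_integerPoints_iff {I : Instance V} (hs : IsSimpleOriented I.graph)
    (hc : I.graph.toSimpleGraphInclusive.Connected) {l : Arc I.graph → ℤ}
    (hl : ∀ a, I.lower a = l a) (hfree : I.IsFree)
    {Γ : Matrix (Fin (cyclomaticNumber I.graph)) (Arc I.graph) ℤ} (hΓ : IsCycleMatrix Γ)
    (z : Fin (cyclomaticNumber I.graph) → ℤ) :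
    z ∈ I.integerPoints Γ ↔ ∃ π p, IsFeasiblePair l I.period π p ∧ Γ.mulVec p = z := by
  have hu : ∀ a, I.upper a = ((l a + I.period - 1 : ℤ) : ℝ) := fun a => by
    have := hfree a
    rw [hl] at this
    push_cast
    linarith
  have hcast : ∀ p : Arc I.graph → ℤ, (Γ.map (fun k : ℤ => (k : ℝ))).mulVec (fun a => (p a : ℝ))
      = fun i => ((Γ.mulVec p i : ℤ) : ℝ) := fun p => by
    funext i
    simp [Matrix.mulVec, dotProduct]
  constructor
  · rintro ⟨x, hx, hb⟩
    obtain ⟨p, hp⟩ := hΓ.mulVec_surjective hs hc z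
    obtain ⟨q, hq⟩ := hΓ.exists_potential hs hc
      (x := x - (I.period : ℝ) • fun a => (p a : ℝ)) (by
        rw [Matrix.mulVec_sub, Matrix.mulVec_smul, hx, hcast, hp, sub_self])
    refine ⟨fun v => ⌊q v⌋, p, fun a => ?_, hp⟩
    have h₁ := hq a
    have h₂ := hb a
    rw [hl, hu] at h₂
    simp only [Pi.sub_apply, Pi.smul_apply, smul_eq_mul] at h₁
    have := floor_difference_bounds (s := q a.tail) (t := q a.head) (m := l a - I.period * p a)
      (k := l a + I.period - 1 - I.period * p a)
      (by push_cast; linarith) (by push_cast at h₂ ⊢; linarith)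
    simp only
    omega
  · rintro ⟨π, p, hf, rfl⟩
    refine ⟨(fun a => ((π a.head : ℝ) - (π a.tail : ℝ))) + (I.period : ℝ) • fun a => (p a : ℝ),
      ?_, fun a => ?_⟩
    · rw [Matrix.mulVec_add, Matrix.mulVec_smul, hcast,
        hΓ.mulVec_coboundary (fun v => (π v : ℝ)), zero_add]
    · rw [hl, hu]
      simp only [Pi.add_apply, Pi.smul_apply, smul_eq_mul]
      exact ⟨by exact_mod_cast (hf a).1, by exact_mod_cast (hf a).2⟩

theorem IsCycleMatrix.mulVec_eq_iff (hs : IsSimpleOriented G)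
    (hc : G.toSimpleGraphInclusive.Connected)
    {Γ : Matrix (Fin (cyclomaticNumber G)) (Arc G) ℤ} (hΓ : IsCycleMatrix Γ) (p p' : Arc G → ℤ) :
    Γ.mulVec p = Γ.mulVec p' ↔ ∃ q : V → ℤ, ∀ a : Arc G, p a - p' a = q a.head - q a.tail := by
  have hmap : Γ.map (fun k : ℤ => (Int.cast k : ℤ)) = Γ := by
    ext
    simp
  rw [← sub_eq_zero, ← Matrix.mulVec_sub]
  constructor
  · intro h
    exact hΓ.exists_potential hs hc (x := p - p') (by rw [hmap]; exact h)
  · rintro ⟨q, hq⟩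
    have := hΓ.mulVec_coboundary q
    rw [hmap] at this
    rwa [show p - p' = fun a => q a.head - q a.tail from funext hq]

end Pesp

/-! ### The bijection between spanning trees and integer points -/

theorem mainTheorem12 {V : Type*} [Finite V] (I : Pesp.Instance V)
    (hsimple : Pesp.IsSimpleOriented I.graph)
    (hconn : I.graph.toSimpleGraphInclusive.Connected)
    (hint : I.IsIntegral)
    (hfree : I.IsFree)
    (hnondeg : I.IsNondegenerate)
    (Γ : Matrix (Fin (Pesp.cyclomaticNumber I.graph)) (Pesp.Arc I.graph) ℤ)
    (hΓ : Pesp.IsCycleMatrix Γ) :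
    (I.integerPoints Γ).encard = (Pesp.spanningTrees I.graph).encard := by
  classical
  choose l hl using fun a => (hint a).1
  obtain ⟨r⟩ := hconn.nonempty
  have hT : (0 : ℤ) < I.period := by exact_mod_cast I.period_pos
  have htree : ∀ S ∈ Pesp.spanningTrees I.graph, ∃ π p, Pesp.IsFeasiblePair l I.period π p ∧
      Pesp.IsReached l I.period r π p ∧ Pesp.tightArcs l I.period π p = S := by
    intro S hS
    obtain ⟨π, p, hf, hr, hc⟩ :=
      Pesp.exists_isReached_of_isSpanningTree hsimple hT r l hS
    have ht := Pesp.isSpanningTree_tightArcs hl hfree hnondeg hf (hr.connected hsimple)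
    refine ⟨π, p, hf, hr, Pesp.arcGraph_injective hsimple ?_⟩
    -- Trees are minimal connected graphs, so the connected intersection of `S` with the tight arcs
    -- equals both.
    have h₁ := (SimpleGraph.isTree_iff_minimal_connected.1 ht).eq_of_le hc
      (Pesp.arcGraph_mono hsimple Set.inter_subset_right)
    have h₂ := (SimpleGraph.isTree_iff_minimal_connected.1 hS).eq_of_le hc
      (Pesp.arcGraph_mono hsimple Set.inter_subset_left)
    exact h₁.symm.trans h₂
  choose! π p hf hr ht using htree
  have himage : (fun S => Γ.mulVec (p S)) '' Pesp.spanningTrees I.graph = I.integerPoints Γ := by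
    ext z
    rw [Pesp.mem_integerPoints_iff hsimple hconn hl hfree hΓ]
    constructor
    · rintro ⟨S, hS, rfl⟩
      exact ⟨π S, p S, hf S hS, rfl⟩
    · rintro ⟨π₀, p₀, hf₀, rfl⟩
      obtain ⟨π₁, hf₁, hr₁⟩ := Pesp.exists_isReached hconn r hf₀
      have hS := Pesp.isSpanningTree_tightArcs hl hfree hnondeg hf₁ (hr₁.connected hsimple)
      refine ⟨_, hS, (hΓ.mulVec_eq_iff hsimple hconn _ _).2 ?_⟩
      exact (hr _ hS).offset_eq hsimple hr₁ (hf _ hS) hf₁ (by rwa [ht _ hS]) (ht _ hS)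
  rw [← himage]
  refine Set.InjOn.encard_image fun S hS S' hS' h => ?_
  obtain ⟨q, hq⟩ := (hΓ.mulVec_eq_iff hsimple hconn _ _).1 h
  rw [← ht S hS, ← ht S' hS']
  exact (hr S hS).tightArcs_eq (hr S' hS') (hf S hS) (hf S' hS') hq
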